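/- For an integer $n\ge 1$ identify $\omega\in S_n$ with the word $\omega(1)\,\omega(2)\cdots\omega(n)$. A simple reduction of $\omega$ is a permutation obtained from $\omega$ by transposing two adjacent entries $\omega(i),\omega(i+1)$ with $\omega(i)>\omega(i+1)$. In the weak Bruhat order, $\pi\preceq\sigma$ means that there is a finite chain $\sigma=\omega_1\to\omega_2\to\cdots\to\omega_s=\pi$ ($s\ge 1$) in which each $\omega_t$ with $t>1$ is a simple reduction of $\omega_{t-1}$. Let $P_n^*:=P(\pi\preceq\sigma)$, where $\pi,\sigma\in S_n$ are chosen independently and uniformly at random. **Theorem.** $P_n^*$ is submultiplicative, i.e. $P_{n_1+n_2}^*\le P_{n_1}^*P_{n_2}^*$ for all $n_1,n_2\ge 1$. Consequently the limit $\rho=\lim_{n\to\infty}\sqrt[n]{P_n^*}$ exists. Furthermore, there exists an absolute constant $c>0$ such that for all $n\ge 1$ \[ \prod_{i=1}^n \frac{H(i)}{i}\;\le\; P_n^*\;\le\; c\,(0.362)^n,\qquad H(i):=\sum_{j=1}^i\frac1j . \] Consequently, $\rho\le 0.362$. -/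

import Mathlib

open Filter Topology MeasureTheory

/-- A permutation `ω` of `Fin n` is identified with the word `ω 0, ω 1, …, ω (n - 1)`.
`SimpleReduction ω ω'` says that `ω'` is obtained from `ω` by transposing two adjacent
entries `ω i > ω (i + 1)` of this word (here `j` is the position `i + 1`). -/
def SimpleReduction {n : ℕ} (ω ω' : Equiv.Perm (Fin n)) : Prop :=
  ∃ i j : Fin n, (j : ℕ) = (i : ℕ) + 1 ∧ ω j < ω i ∧ ω' = ω * Equiv.swap i j

/-- The weak Bruhat order: `π ⪯ σ` if there is a (possibly trivial) finite chain of simple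
reductions leading from `σ` down to `π`. -/
def WeakBruhatLE {n : ℕ} (π σ : Equiv.Perm (Fin n)) : Prop :=
  Relation.ReflTransGen SimpleReduction σ π

/-- The symmetric group is a finite probability space: every subset is measurable. -/
instance permMeasurableSpace (n : ℕ) : MeasurableSpace (Equiv.Perm (Fin n)) := ⊤

/-- The uniform probability distribution on the symmetric group `S_n`. -/
noncomputable def uniformPerm (n : ℕ) : Measure (Equiv.Perm (Fin n)) :=
  (PMF.uniformOfFintype (Equiv.Perm (Fin n))).toMeasure

/-- `P_n^*`: the probability that `π ⪯ σ` in the weak Bruhat order, for independent and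
uniformly random `π, σ ∈ S_n`. -/
noncomputable def weakBruhatProb (n : ℕ) : ℝ :=
  ((uniformPerm n).prod (uniformPerm n)).real {p | WeakBruhatLE p.1 p.2}

/-! # Comparable pairs in the weak Bruhat order

The weak order is containment of inversion sets: writing `p = π⁻¹` and `s = σ⁻¹`, one has `π ⪯ σ`
exactly when `a < b` and `s a < s b` imply `p a < p b` (`weakBruhatLE_iff`). Hence
`weakBruhatProb n` is the number of such pairs `(p, s)` divided by `n! ^ 2`.

*Submultiplicativity.* The condition passes to the patterns of `p` and `s` on the first `m` and the
last `n` elements, and each pair of patterns arises from `(m + n).choose m` permutations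
(`noninvPairs_add_le`).

*Both bounds.* For fixed `s`, the permutations `p` are the linear extensions of the two-dimensional
poset `PermPoset s`. The number `e` of linear extensions satisfies `e(P) = ∑ m, e(P \ {m})`, the sum
being over the maximal elements (`card_linExt_succ`). By induction this recursion yields

* the hook inequality `e(P) ≥ n! / ∏ a, |Iic a|` (`factorial_mul_prod_le_card_linExt`). For random
  `s`, the ideal of the element number `i` has size uniform on `{1, …, i}`, independently for
  different `i`, so that averaging the inequality gives `∏ i, H(i) / i`
  (`sum_prod_inv_idealCard`);
* the estimate `e(P) ≤ k ^ n` if antichains have at most `k` elements (`card_linExt_le_pow`). An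
  antichain of `k` elements in `PermPoset s` is a decreasing subword of `s`, which exists with
  probability at most `n.choose k / k!`. Therefore
  `weakBruhatProb n ≤ k ^ n / n! + 2 ^ n / k!` (`weakBruhatProb_le`).

Taking `k` to be a small multiple of `n` in the last bound shows that `weakBruhatProb n` decays
faster than `r ^ n` for every `r > 0` (`exists_weakBruhatProb_le`). The case `r = 0.362` is the
required upper bound, and letting `r → 0` shows that the limit of the `n`-th roots is `0`.
-/

/-! ### Inversions and the weak order -/

/-- `NoninvLE p s`: every non-inversion of `s` is a non-inversion of `p`. Here a non-inversion of
`s` is a pair `a < b` with `s a < s b`; the weak order on `π, σ` is expressed by `p = π⁻¹` and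
`s = σ⁻¹`. -/
def NoninvLE {n : ℕ} (p s : Equiv.Perm (Fin n)) : Prop :=
  ∀ a b : Fin n, a < b → s a < s b → p a < p b

theorem noninvLE_of_simpleReduction {n : ℕ} {σ τ : Equiv.Perm (Fin n)}
    (h : SimpleReduction σ τ) : NoninvLE τ⁻¹ σ⁻¹ := by
  obtain ⟨i, j, hij, hlt, rfl⟩ := h
  intro a b hab hs
  obtain ⟨x, rfl⟩ := σ.surjective a
  obtain ⟨y, rfl⟩ := σ.surjective b
  simp only [mul_inv_rev, Equiv.swap_inv, Equiv.Perm.mul_apply,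
    Equiv.Perm.coe_inv, Equiv.symm_apply_apply] at hs ⊢
  have hne : ¬ (x = i ∧ y = j) := by
    rintro ⟨rfl, rfl⟩
    exact absurd hab hlt.not_gt
  simp only [Equiv.swap_apply_def]
  split_ifs <;> simp only [Fin.lt_def, Fin.ext_iff] at * <;> omega

theorem noninvLE_of_weakBruhatLE {n : ℕ} {π σ : Equiv.Perm (Fin n)} (h : WeakBruhatLE π σ) :
    NoninvLE π⁻¹ σ⁻¹ := by
  induction h with
  | refl => exact fun _ _ _ h => h
  | tail _ h ih => exact fun a b hab hs => noninvLE_of_simpleReduction h a b hab (ih a b hab hs)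

/-- If the non-inversions of `σ` are non-inversions of `π ≠ σ`, then `σ` has a descent which is
not an inversion of `π`. -/
theorem exists_descent {n : ℕ} {π σ : Equiv.Perm (Fin n)} (h : NoninvLE π⁻¹ σ⁻¹) (hne : π ≠ σ) :
    ∃ i j : Fin n, (j : ℕ) = (i : ℕ) + 1 ∧ σ j < σ i ∧ π⁻¹ (σ j) < π⁻¹ (σ i) := by
  by_contra! hcon
  apply hne
  obtain _ | n := n
  · exact Subsingleton.elim _ _
  -- Otherwise `π⁻¹ * σ` increases on adjacent positions, both at ascents and at descents of `σ`.
  have hmono : StrictMono (π⁻¹ * σ) := by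
    rw [Fin.strictMono_iff_lt_succ]
    intro i
    have hlt : i.castSucc < i.succ := Fin.castSucc_lt_succ
    rcases lt_trichotomy (σ i.castSucc) (σ i.succ) with h1 | h1 | h1
    · exact h _ _ h1 (by simp)
    · exact absurd (σ.injective h1) hlt.ne
    · refine lt_of_le_of_ne (hcon _ _ (by simp) h1) fun he => hlt.ne ?_
      exact (π⁻¹ * σ).injective he
  have hid : (π⁻¹ * σ : Equiv.Perm (Fin (n + 1))) = 1 := by
    ext1 x
    exact congrFun ((StrictMono.range_inj hmono strictMono_id).1
      (by rw [(π⁻¹ * σ).surjective.range_eq, Set.range_id])) x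
  exact inv_mul_eq_one.1 hid

/-- The weak order is containment of inversion sets. The entries `a, b` are compared as values, so
their positions in the words are `π⁻¹ a, π⁻¹ b` and `σ⁻¹ a, σ⁻¹ b`. -/
theorem weakBruhatLE_iff {n : ℕ} {π σ : Equiv.Perm (Fin n)} :
    WeakBruhatLE π σ ↔ NoninvLE π⁻¹ σ⁻¹ := by
  refine ⟨noninvLE_of_weakBruhatLE, ?_⟩
  -- Induction on the number of inversions of `σ`.
  induction hN : {x : Fin n × Fin n | x.1 < x.2 ∧ σ⁻¹ x.2 < σ⁻¹ x.1}.ncard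
    using Nat.strong_induction_on generalizing σ with
  | _ N ih =>
  intro h
  by_cases hne : π = σ
  · subst hne
    exact Relation.ReflTransGen.refl
  obtain ⟨i, j, hij, hlt, hp⟩ := exists_descent h hne
  have hred : SimpleReduction σ (σ * Equiv.swap i j) := ⟨i, j, hij, hlt, rfl⟩
  refine Relation.ReflTransGen.head hred (ih _ ?_ rfl ?_)
  · rw [← hN]
    refine Set.ncard_lt_ncard ⟨?_, ?_⟩ (Set.toFinite _)
    · rintro ⟨a, b⟩ ⟨hab, hb⟩
      refine ⟨hab, lt_of_le_of_ne (not_lt.1 fun hs => ?_) fun he => ?_⟩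
      · exact absurd (noninvLE_of_simpleReduction hred a b hab hs) hb.not_gt
      · exact hab.ne' (σ⁻¹.injective he)
    · intro hsub
      have hij' : i < j := by rw [Fin.lt_def]; omega
      have := @hsub (σ j, σ i) ⟨hlt, by simpa using hij'⟩
      simp only [Set.mem_ofPred_eq, mul_inv_rev, Equiv.swap_inv, Equiv.Perm.mul_apply,
        Equiv.Perm.coe_inv, Equiv.symm_apply_apply, Equiv.swap_apply_left,
        Equiv.swap_apply_right] at this
      exact absurd this.2 hij'.not_gt
  · intro a b hab hs
    obtain ⟨x, rfl⟩ := σ.surjective a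
    obtain ⟨y, rfl⟩ := σ.surjective b
    by_cases hxy : x = j ∧ y = i
    · rw [hxy.1, hxy.2]
      exact hp
    refine h _ _ hab ?_
    simp only [mul_inv_rev, Equiv.swap_inv, Equiv.Perm.mul_apply,
      Equiv.Perm.coe_inv, Equiv.symm_apply_apply, Equiv.swap_apply_def] at hs ⊢
    split_ifs at hs <;> simp only [Fin.lt_def, Fin.ext_iff] at * <;> omega

/-- The number of pairs `(p, s)` of permutations of `Fin n` such that every non-inversion of `s`
is a non-inversion of `p`. -/
noncomputable def noninvPairs (n : ℕ) : ℕ :=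
  Nat.card {q : Equiv.Perm (Fin n) × Equiv.Perm (Fin n) // NoninvLE q.1 q.2}

theorem weakBruhatProb_eq (n : ℕ) :
    weakBruhatProb n = noninvPairs n / (n.factorial : ℝ) ^ 2 := by
  classical
  have : IsProbabilityMeasure (uniformPerm n) := by unfold uniformPerm; infer_instance
  have hcard : noninvPairs n
      = (Finset.univ.filter fun q : Equiv.Perm (Fin n) × Equiv.Perm (Fin n) =>
          WeakBruhatLE q.1 q.2).card := by
    rw [noninvPairs, ← Fintype.card_subtype, ← Nat.card_eq_fintype_card]
    exact Nat.card_congr (((Equiv.inv _).prodCongr (Equiv.inv _)).subtypeEquiv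
      fun q => by simp [weakBruhatLE_iff])
  have hset : {p : Equiv.Perm (Fin n) × Equiv.Perm (Fin n) | WeakBruhatLE p.1 p.2}
      = ((Finset.univ.filter fun q : Equiv.Perm (Fin n) × Equiv.Perm (Fin n) =>
          WeakBruhatLE q.1 q.2 : Finset _) : Set _) := by ext; simp
  have hsing (π : Equiv.Perm (Fin n)) : (uniformPerm n).real {π} = (n.factorial : ℝ)⁻¹ := by
    rw [Measure.real, uniformPerm,
      PMF.toMeasure_apply_singleton _ _ (MeasurableSet.of_discrete)]
    simp [Fintype.card_perm]
  rw [weakBruhatProb, hset, ← sum_measureReal_singleton, hcard]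
  have (q : Equiv.Perm (Fin n) × Equiv.Perm (Fin n)) :
      ((uniformPerm n).prod (uniformPerm n)).real {q} = ((n.factorial : ℝ) ^ 2)⁻¹ := by
    obtain ⟨π, σ⟩ := q
    rw [← Set.singleton_prod_singleton, measureReal_prod_prod, hsing, hsing]
    ring
  simp only [this, Finset.sum_const, nsmul_eq_mul]
  rfl

/-! ### Submultiplicativity -/

/-- The pattern of an injective word `f`: the permutation ordered like `f`. -/
noncomputable def pattern {m : ℕ} {β : Type*} [LinearOrder β] (f : Fin m → β) :
    Equiv.Perm (Fin m) := (Tuple.sort f)⁻¹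

theorem strictMono_comp_pattern_inv {m : ℕ} {β : Type*} [LinearOrder β] {f : Fin m → β}
    (hf : Function.Injective f) : StrictMono (f ∘ ⇑(pattern f)⁻¹) := by
  rw [pattern, inv_inv]
  exact (Tuple.monotone_sort f).strictMono_of_injective (hf.comp (Equiv.injective _))

theorem pattern_lt_iff {m : ℕ} {β : Type*} [LinearOrder β] {f : Fin m → β}
    (hf : Function.Injective f) {a b : Fin m} : pattern f a < pattern f b ↔ f a < f b := by
  simpa using ((strictMono_comp_pattern_inv hf).lt_iff_lt (a := pattern f a)
    (b := pattern f b)).symm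

theorem eq_of_pattern_eq {m : ℕ} {β : Type*} [LinearOrder β] {f g : Fin m → β}
    (hf : Function.Injective f) (hg : Function.Injective g) (h : pattern f = pattern g)
    (hr : Set.range f = Set.range g) : f = g := by
  have := (StrictMono.range_inj (strictMono_comp_pattern_inv hf)
    (strictMono_comp_pattern_inv hg)).1 (by
      rw [Set.range_comp, Set.range_comp, Equiv.range_eq_univ, Equiv.range_eq_univ,
        Set.image_univ, Set.image_univ, hr])
  rw [h] at this
  exact (pattern g)⁻¹.surjective.injective_comp_right this

/-- Restrict `p` and `s` to the first `m` and the last `n` elements. Non-inversions restrict to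
non-inversions of the patterns, and `p` is recovered from its two patterns and from the set of
values on the first block, for which there are `(m + n).choose m` possibilities. -/
theorem noninvPairs_add_le (m n : ℕ) :
    noninvPairs (m + n) ≤ (m + n).choose m ^ 2 * (noninvPairs m * noninvPairs n) := by
  classical
  have hl (p : Equiv.Perm (Fin (m + n))) : Function.Injective (p ∘ Fin.castAdd n) :=
    p.injective.comp (Fin.castAdd_injective m n)
  have hr (p : Equiv.Perm (Fin (m + n))) : Function.Injective (p ∘ Fin.natAdd m) :=
    p.injective.comp (Fin.natAdd_injective n m)
  let img (p : Equiv.Perm (Fin (m + n))) : {A : Finset (Fin (m + n)) // A.card = m} :=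
    ⟨Finset.univ.image (p ∘ Fin.castAdd n), by
      rw [Finset.card_image_of_injective _ (hl p), Finset.card_univ, Fintype.card_fin]⟩
  -- A permutation is determined by its patterns on the two blocks and the image of the first one.
  have hinj (p q : Equiv.Perm (Fin (m + n))) (h1 : img p = img q)
      (h2 : pattern (p ∘ Fin.castAdd n) = pattern (q ∘ Fin.castAdd n))
      (h3 : pattern (p ∘ Fin.natAdd m) = pattern (q ∘ Fin.natAdd m)) : p = q := by
    have hrange : Set.range (p ∘ Fin.castAdd n) = Set.range (q ∘ Fin.castAdd n) := by
      have := congrArg (fun A => (A.1 : Set (Fin (m + n)))) h1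
      simpa [img, -Function.comp_apply, Function.comp_def] using this
    have hcompl (p : Equiv.Perm (Fin (m + n))) :
        Set.range (p ∘ Fin.natAdd m) = (Set.range (p ∘ Fin.castAdd n))ᶜ := by
      rw [Set.range_comp, Set.range_comp, ← Set.image_compl_eq p.bijective]
      congr 1
      ext x
      induction x using Fin.addCases with
      | left i => simp [Fin.ext_iff]; intro y; omega
      | right i => simp [Fin.ext_iff]; intro y; omega
    have e1 := eq_of_pattern_eq (hl p) (hl q) h2 hrange
    have e2 := eq_of_pattern_eq (hr p) (hr q) h3 (by rw [hcompl, hcompl, hrange])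
    ext1 x
    induction x using Fin.addCases with
    | left i => exact congrFun e1 i
    | right i => exact congrFun e2 i
  let F (q : {q : Equiv.Perm (Fin (m + n)) × Equiv.Perm (Fin (m + n)) // NoninvLE q.1 q.2}) :
      ({A : Finset (Fin (m + n)) // A.card = m} × {A : Finset (Fin (m + n)) // A.card = m}) ×
      ({q : Equiv.Perm (Fin m) × Equiv.Perm (Fin m) // NoninvLE q.1 q.2} ×
        {q : Equiv.Perm (Fin n) × Equiv.Perm (Fin n) // NoninvLE q.1 q.2}) :=
    ((img q.1.1, img q.1.2),
      (⟨(pattern (q.1.1 ∘ Fin.castAdd n), pattern (q.1.2 ∘ Fin.castAdd n)), by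
        intro a b hab hs
        replace hs := (pattern_lt_iff (hl _)).1 hs
        refine (pattern_lt_iff (hl _)).2 ?_
        exact q.2 _ _ (Fin.strictMono_castAdd n hab) hs⟩,
      ⟨(pattern (q.1.1 ∘ Fin.natAdd m), pattern (q.1.2 ∘ Fin.natAdd m)), by
        intro a b hab hs
        replace hs := (pattern_lt_iff (hr _)).1 hs
        refine (pattern_lt_iff (hr _)).2 ?_
        exact q.2 _ _ (Fin.strictMono_natAdd m hab) hs⟩))
  have hF : Function.Injective F := by
    rintro ⟨⟨p, s⟩, hps⟩ ⟨⟨p', s'⟩, hps'⟩ h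
    obtain ⟨h1, h2⟩ := Prod.ext_iff.1 h
    obtain ⟨hp, hs⟩ := Prod.ext_iff.1 h1
    obtain ⟨hpl, hsl⟩ := Prod.ext_iff.1 (congrArg (fun x => x.1.1) h2)
    obtain ⟨hpr, hsr⟩ := Prod.ext_iff.1 (congrArg (fun x => x.2.1) h2)
    exact Subtype.ext (Prod.ext (hinj _ _ hp hpl hpr) (hinj _ _ hs hsl hsr))
  have hA : Nat.card {A : Finset (Fin (m + n)) // A.card = m} = (m + n).choose m := by
    rw [Nat.card_eq_fintype_card, Fintype.card_finset_len, Fintype.card_fin]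
  have := Nat.card_le_card_of_injective F hF
  rw [Nat.card_prod, Nat.card_prod, Nat.card_prod, hA, ← sq] at this
  exact this

theorem weakBruhatProb_add_le (m n : ℕ) :
    weakBruhatProb (m + n) ≤ weakBruhatProb m * weakBruhatProb n := by
  have hC : ((m + n).factorial : ℝ) = (m + n).choose m * m.factorial * n.factorial := by
    rw [Nat.choose_symm_add]
    exact_mod_cast (Nat.add_choose_mul_factorial_mul_factorial m n).symm
  have hpos : (0 : ℝ) < (m + n).choose m := by
    exact_mod_cast Nat.choose_pos (Nat.le_add_right m n)
  have hle : (noninvPairs (m + n) : ℝ)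
      ≤ (m + n).choose m ^ 2 * (noninvPairs m * noninvPairs n) := by
    exact_mod_cast noninvPairs_add_le m n
  rw [weakBruhatProb_eq, weakBruhatProb_eq, weakBruhatProb_eq, div_le_iff₀ (by positivity), hC]
  refine hle.trans (le_of_eq ?_)
  field_simp

/-! ### Linear extensions of a finite poset -/

/-- The linear extensions of a poset with `n` elements, as strictly increasing bijections onto
`Fin n`. -/
def LinExt (α : Type*) [Preorder α] (n : ℕ) : Type _ := {p : α ≃ Fin n // StrictMono p}

instance (α : Type*) [Preorder α] [Finite α] (n : ℕ) : Finite (LinExt α n) := by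
  unfold LinExt; infer_instance

open Classical in
/-- Extend a bijection `{x // x ≠ m} ≃ Fin n` by giving `m` the largest value. -/
noncomputable def extendTop {α : Type*} {n : ℕ} (m : α) (q : {x // x ≠ m} ≃ Fin n) :
    α ≃ Fin (n + 1) :=
  (Equiv.optionSubtypeNe m).symm.trans (q.optionCongr.trans finSuccEquivLast.symm)

theorem extendTop_self {α : Type*} {n : ℕ} (m : α) (q : {x // x ≠ m} ≃ Fin n) :
    extendTop m q m = Fin.last n := by
  simp [extendTop]

theorem extendTop_of_ne {α : Type*} {n : ℕ} (m : α) (q : {x // x ≠ m} ≃ Fin n) {x : α}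
    (hx : x ≠ m) : extendTop m q x = (q ⟨x, hx⟩).castSucc := by
  classical
  simp [extendTop, hx]

/-- Removing the last element of a linear extension, which is a maximal element of the poset. -/
noncomputable def linExtSuccEquiv (α : Type*) [PartialOrder α] (n : ℕ) :
    (Σ m : {m : α // IsMax m}, LinExt {x // x ≠ m.1} n) ≃ LinExt α (n + 1) :=
  Equiv.ofBijective
    (fun y => ⟨extendTop y.1.1 y.2.1, by
      obtain ⟨⟨m, hm⟩, q, hq⟩ := y
      intro a b hab
      have ha : a ≠ m := fun h => hm.not_lt (h ▸ hab)
      rw [extendTop_of_ne m q ha]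
      by_cases hb : b = m
      · rw [hb, extendTop_self]
        exact Fin.castSucc_lt_last _
      · rw [extendTop_of_ne m q hb]
        exact hq hab⟩)
    ⟨by
      rintro ⟨⟨m, hm⟩, q, hq⟩ ⟨⟨m', hm'⟩, q', hq'⟩ h
      have h : extendTop m q = extendTop m' q' := congrArg Subtype.val h
      obtain rfl : m = m' := (extendTop m q).injective (by
        rw [extendTop_self, h, extendTop_self])
      obtain rfl : q = q' := by
        ext1 x
        have := DFunLike.congr_fun h x.1
        rwa [extendTop_of_ne m q x.2, extendTop_of_ne m q' x.2, Fin.castSucc_inj] at this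
      rfl, by
      rintro ⟨p, hp⟩
      have hm : IsMax (p.symm (Fin.last n)) := by
        intro x hx
        by_contra hlt
        have := hp (lt_of_le_not_ge hx hlt)
        rw [Equiv.apply_symm_apply] at this
        exact absurd this (Fin.le_last _).not_gt
      have hx (x : α) : x ≠ p.symm (Fin.last n) ↔ p x ∈ {y | y ≠ Fin.last n} := by
        change _ ↔ ¬ p x = _
        rw [Ne, Equiv.eq_symm_apply]
      let q : {x // x ≠ p.symm (Fin.last n)} ≃ Fin n :=
        (p.subtypeEquiv hx).trans (finSuccAboveEquiv (Fin.last n)).symm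
      have hq (x) : (q x).castSucc = p x.1 := by
        have : finSuccAboveEquiv (Fin.last n) (q x) = p.subtypeEquiv hx x := by simp [q]
        rw [← Fin.succAbove_last_apply]
        exact congrArg Subtype.val this
      refine ⟨⟨⟨_, hm⟩, q, fun x y hxy => ?_⟩, Subtype.ext (Equiv.ext fun x => ?_)⟩
      · rw [← Fin.castSucc_lt_castSucc_iff, hq, hq]
        exact hp hxy
      · by_cases h : x = p.symm (Fin.last n)
        · simp [h, extendTop_self]
        · exact (extendTop_of_ne _ q h).trans (hq _)⟩

theorem card_linExt_succ (α : Type*) [PartialOrder α] [Finite α] [Fintype {m : α // IsMax m}]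
    (n : ℕ) : Nat.card (LinExt α (n + 1))
      = ∑ m : {m : α // IsMax m}, Nat.card (LinExt {x // x ≠ m.1} n) := by
  rw [← Nat.card_congr (linExtSuccEquiv α n), Nat.card_sigma]

theorem card_linExt_zero (α : Type*) [PartialOrder α] [IsEmpty α] :
    Nat.card (LinExt α 0) = 1 := by
  rw [Nat.card_eq_one_iff_unique]
  exact ⟨⟨fun p q => Subtype.ext (Subsingleton.elim _ _)⟩,
    ⟨⟨Equiv.equivOfIsEmpty _ _, fun a => isEmptyElim a⟩⟩⟩

/-- A poset of `n` elements in which antichains have at most `k` elements has at most `k ^ n`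
linear extensions: each of the `n` successive maximal elements is chosen from an antichain. -/
theorem card_linExt_le_pow (n k : ℕ) (α : Type) [PartialOrder α] [Fintype α]
    (hn : Fintype.card α = n)
    (hk : ∀ A : Finset α, IsAntichain (· ≤ ·) (A : Set α) → A.card ≤ k) :
    Nat.card (LinExt α n) ≤ k ^ n := by
  classical
  induction n generalizing α with
  | zero =>
    have := Fintype.card_eq_zero_iff.1 hn
    rw [card_linExt_zero, pow_zero]
  | succ n ih =>
    rw [card_linExt_succ]
    calc _ ≤ ∑ m : {m : α // IsMax m}, k ^ n := by
          refine Finset.sum_le_sum fun m _ => ih _ ?_ fun A hA => ?_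
          · rw [Fintype.card_subtype_compl, hn, Fintype.card_subtype_eq]; rfl
          · rw [← Finset.card_map (Function.Embedding.subtype _)]
            refine hk _ ?_
            rw [Finset.coe_map]
            exact hA.image_embedding (OrderEmbedding.subtype _)
      _ ≤ _ := by
          rw [Finset.sum_const, smul_eq_mul, pow_succ', Finset.card_univ, Fintype.card_subtype]
          refine Nat.mul_le_mul_right _ (hk _ fun a ha b hb hab hle => hab ?_)
          exact (Finset.mem_filter.1 (Finset.mem_coe.1 ha)).2.eq_of_le hle

/-- The hook inequality: a poset of `n` elements has at least `n! / ∏ a, |Iic a|` linear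
extensions. In the induction, the last element of a linear extension ranges over the maximal
elements `m`; removing `m` deletes one factor `|Iic m|`, and `∑ m, |Iic m|` is at least the number
of elements because every element lies below a maximal one. -/
theorem factorial_mul_prod_le_card_linExt (n : ℕ) (α : Type) [PartialOrder α] [Fintype α]
    (hn : Fintype.card α = n) :
    (n.factorial : ℝ) * ∏ a : α, ((Set.Iic a).ncard : ℝ)⁻¹ ≤ Nat.card (LinExt α n) := by
  classical
  induction n generalizing α with
  | zero =>
    have := Fintype.card_eq_zero_iff.1 hn
    simp [card_linExt_zero]
  | succ n ih =>
    have hpos (a : α) : (0 : ℝ) < (Set.Iic a).ncard := by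
      exact Nat.cast_pos.2 ((Set.ncard_pos (Set.toFinite _)).2 ⟨a, le_refl a⟩)
    rw [card_linExt_succ, Nat.cast_sum]
    have hcover : ((n + 1 : ℕ) : ℝ) ≤ ∑ m : {m : α // IsMax m}, ((Set.Iic m.1).ncard : ℝ) := by
      rw [← hn, ← Finset.card_univ]
      have hsub : (Finset.univ : Finset α)
          ⊆ Finset.univ.biUnion fun m : {m : α // IsMax m} => (Set.Iic m.1).toFinset := by
        intro x _
        obtain ⟨m, hxm, hm⟩ := (Set.toFinite (Set.univ : Set α)).exists_le_maximal
          (Set.mem_univ x)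
        have : IsMax m := fun y hy => hm.2 (Set.mem_univ y) hy
        exact Finset.mem_biUnion.2 ⟨⟨m, this⟩, Finset.mem_univ _, by simpa using hxm⟩
      have := (Finset.card_le_card hsub).trans Finset.card_biUnion_le
      simp only [← Set.ncard_eq_toFinset_card'] at this
      exact_mod_cast this
    have hstep (m : {m : α // IsMax m}) :
        (n.factorial : ℝ) * ((∏ a : α, ((Set.Iic a).ncard : ℝ)⁻¹) * (Set.Iic m.1).ncard)
          ≤ Nat.card (LinExt {x // x ≠ m.1} n) := by
      have hc : Fintype.card {x // x ≠ m.1} = n := by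
        rw [Fintype.card_subtype_compl, hn, Fintype.card_subtype_eq]; rfl
      refine le_trans (le_of_eq ?_) (ih _ hc)
      congr 1
      -- The principal ideals of the other elements do not contain the maximal element `m`.
      have hIic (x : {x // x ≠ m.1}) : (Set.Iic x).ncard = (Set.Iic x.1).ncard := by
        rw [← Set.ncard_image_of_injective _ Subtype.val_injective]
        congr 1
        ext y
        constructor
        · rintro ⟨z, hz, rfl⟩
          exact hz
        · intro hy
          exact ⟨⟨y, fun h => x.2 (m.2.eq_of_le (h ▸ hy)).symm⟩, hy, rfl⟩
      simp only [hIic]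
      rw [Fintype.prod_eq_mul_prod_subtype_ne _ m.1]
      have := (hpos m.1).ne'
      field_simp
    calc ((n + 1).factorial : ℝ) * ∏ a : α, ((Set.Iic a).ncard : ℝ)⁻¹
        = n.factorial * ((∏ a : α, ((Set.Iic a).ncard : ℝ)⁻¹) * ((n + 1 : ℕ) : ℝ)) := by
          rw [Nat.factorial_succ]; push_cast; ring
      _ ≤ n.factorial * ((∏ a : α, ((Set.Iic a).ncard : ℝ)⁻¹)
            * ∑ m : {m : α // IsMax m}, ((Set.Iic m.1).ncard : ℝ)) := by
          have : 0 ≤ ∏ a : α, ((Set.Iic a).ncard : ℝ)⁻¹ :=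
            Finset.prod_nonneg fun a _ => inv_nonneg.2 (hpos a).le
          gcongr
      _ ≤ _ := by
          rw [Finset.mul_sum, Finset.mul_sum]
          exact Finset.sum_le_sum fun m _ => hstep m

/-! ### The two-dimensional poset of a permutation -/

/-- The two-dimensional poset of a permutation `s`: the ground set is `Fin n`, and `a ≤ b` when
both `a ≤ b` and `s a ≤ s b` in `Fin n`. -/
def PermPoset {n : ℕ} (_s : Equiv.Perm (Fin n)) : Type := Fin n

instance {n : ℕ} (s : Equiv.Perm (Fin n)) : Fintype (PermPoset s) :=
  inferInstanceAs (Fintype (Fin n))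

instance {n : ℕ} (s : Equiv.Perm (Fin n)) : PartialOrder (PermPoset s) :=
  PartialOrder.lift (fun a : Fin n => (a, s a)) fun _ _ h => congrArg Prod.fst h

theorem PermPoset.lt_iff {n : ℕ} (s : Equiv.Perm (Fin n)) (a b : Fin n) :
    @LT.lt (PermPoset s) _ a b ↔ a < b ∧ s a < s b := by
  change (a, s a) < (b, s b) ↔ _
  rw [Prod.mk_lt_mk]
  constructor
  · rintro (⟨h1, h2⟩ | ⟨h1, h2⟩)
    · exact ⟨h1, lt_of_le_of_ne h2 fun h => h1.ne (s.injective h)⟩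
    · exact ⟨lt_of_le_of_ne h1 fun h => h2.ne (congrArg s h), h2⟩
  · rintro ⟨h1, h2⟩
    exact Or.inl ⟨h1, h2.le⟩

/-- The permutations `p` whose non-inversions include those of `s` are the linear extensions of
`PermPoset s`. -/
theorem noninvPairs_eq_sum (n : ℕ) :
    noninvPairs n = ∑ s : Equiv.Perm (Fin n), Nat.card (LinExt (PermPoset s) n) := by
  rw [← Nat.card_sigma, noninvPairs]
  exact Nat.card_congr
    { toFun := fun q => ⟨q.1.2, q.1.1, fun a b hab =>
        q.2 a b ((PermPoset.lt_iff _ a b).1 hab).1 ((PermPoset.lt_iff _ a b).1 hab).2⟩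
      invFun := fun y => ⟨(y.2.1, y.1), fun a b hab hs =>
        y.2.2 ((PermPoset.lt_iff y.1 a b).2 ⟨hab, hs⟩)⟩
      left_inv := fun _ => rfl
      right_inv := fun _ => rfl }

/-! ### The lower bound -/

/-- The number of `b ≤ a` with `s b ≤ s a`, i.e. the size of the principal ideal of `a` in
`PermPoset s`. -/
noncomputable def idealCard {n : ℕ} (s : Equiv.Perm (Fin n)) (a : Fin n) : ℕ :=
  {b : Fin n | b ≤ a ∧ s b ≤ s a}.ncard

/-- Append a last letter `k` to the word of `s`, raising the letters `≥ k` by one. -/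
def insertLast {n : ℕ} (k : Fin (n + 1)) (s : Equiv.Perm (Fin n)) : Equiv.Perm (Fin (n + 1)) :=
  finSuccEquivLast.trans (s.optionCongr.trans (finSuccEquiv' k).symm)

theorem insertLast_last {n : ℕ} (k : Fin (n + 1)) (s : Equiv.Perm (Fin n)) :
    insertLast k s (Fin.last n) = k := by
  simp [insertLast]

theorem insertLast_castSucc {n : ℕ} (k : Fin (n + 1)) (s : Equiv.Perm (Fin n)) (a : Fin n) :
    insertLast k s a.castSucc = k.succAbove (s a) := by
  simp [insertLast]

theorem insertLast_bijective (n : ℕ) :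
    Function.Bijective fun q : Fin (n + 1) × Equiv.Perm (Fin n) => insertLast q.1 q.2 := by
  rw [Fintype.bijective_iff_injective_and_card]
  refine ⟨?_, by simp [Fintype.card_perm, Nat.factorial_succ]⟩
  rintro ⟨k, s⟩ ⟨k', s'⟩ h
  simp only at h
  obtain rfl : k = k' := by rw [← insertLast_last k s, h, insertLast_last]
  refine Prod.ext rfl (Equiv.ext fun a => ?_)
  have := DFunLike.congr_fun h a.castSucc
  rwa [insertLast_castSucc, insertLast_castSucc, Fin.succAbove_right_inj] at this

theorem idealCard_insertLast_last {n : ℕ} (k : Fin (n + 1)) (s : Equiv.Perm (Fin n)) :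
    idealCard (insertLast k s) (Fin.last n) = k + 1 := by
  have : {b : Fin (n + 1) | b ≤ Fin.last n ∧ insertLast k s b ≤ insertLast k s (Fin.last n)}
      = (insertLast k s).symm '' Set.Iic k := by
    ext b
    simp [insertLast_last, Fin.le_last]
  rw [idealCard, this, Set.ncard_image_of_injective _ (Equiv.injective _),
    Set.ncard_eq_toFinset_card']
  simp

theorem idealCard_insertLast_castSucc {n : ℕ} (k : Fin (n + 1)) (s : Equiv.Perm (Fin n))
    (a : Fin n) : idealCard (insertLast k s) a.castSucc = idealCard s a := by
  rw [idealCard, idealCard, ← Set.ncard_image_of_injective _ (Fin.castSucc_injective n)]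
  congr 1
  ext b
  induction b using Fin.lastCases with
  | last => simp [(Fin.castSucc_lt_last a).not_ge, (Fin.castSucc_lt_last _).ne]
  | cast b => simp [insertLast_castSucc, Fin.succAbove_le_succAbove_iff]

/-- Under the uniform distribution the numbers `idealCard s a` are independent and uniform on
`{1, …, a + 1}`; this is the resulting expectation of the product of their inverses. -/
theorem sum_prod_inv_idealCard (n : ℕ) :
    ∑ s : Equiv.Perm (Fin n), ∏ a : Fin n, (idealCard s a : ℝ)⁻¹
      = n.factorial * ∏ i ∈ Finset.Icc 1 n, ((harmonic i : ℚ) : ℝ) / (i : ℝ) := by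
  induction n with
  | zero => simp
  | succ n ih =>
    rw [← (insertLast_bijective n).sum_comp, Fintype.sum_prod_type]
    simp only [Fin.prod_univ_castSucc, idealCard_insertLast_last, idealCard_insertLast_castSucc]
    simp only [← Finset.sum_mul, ih]
    rw [← Finset.mul_sum, Finset.prod_Icc_succ_top (Nat.le_add_left 1 n)]
    have : ∑ k : Fin (n + 1), (((k : ℕ) + 1 : ℕ) : ℝ)⁻¹ = ((harmonic (n + 1) : ℚ) : ℝ) := by
      rw [Fin.sum_univ_eq_sum_range fun k => ((k + 1 : ℕ) : ℝ)⁻¹]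
      simp [harmonic]
    rw [this, Nat.factorial_succ]
    push_cast
    field_simp

/-- The hook inequality, averaged over `s`. -/
theorem prod_harmonic_div_le_weakBruhatProb (n : ℕ) :
    ∏ i ∈ Finset.Icc 1 n, ((harmonic i : ℚ) : ℝ) / (i : ℝ) ≤ weakBruhatProb n := by
  rw [weakBruhatProb_eq, le_div_iff₀ (by positivity), noninvPairs_eq_sum, Nat.cast_sum]
  calc _ = n.factorial * ∑ s : Equiv.Perm (Fin n), ∏ a : Fin n, (idealCard s a : ℝ)⁻¹ := by
        rw [sum_prod_inv_idealCard]; ring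
    _ ≤ _ := by
        rw [Finset.mul_sum]
        exact Finset.sum_le_sum fun s _ =>
          factorial_mul_prod_le_card_linExt n (PermPoset s) (Fintype.card_fin n)

/-! ### The upper bound -/

/-- A permutation which decreases on `A` is determined by its values off `A`. -/
theorem card_strictAntiOn_le {n : ℕ} (A : Finset (Fin n)) :
    Nat.card {s : Equiv.Perm (Fin n) // StrictAntiOn s A} ≤ n.descFactorial (n - A.card) := by
  classical
  let F (s : {s : Equiv.Perm (Fin n) // StrictAntiOn s A}) : {x // x ∉ A} ↪ Fin n :=
    (Function.Embedding.subtype _).trans s.1.toEmbedding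
  have hF : Function.Injective F := by
    rintro ⟨s, hs⟩ ⟨t, ht⟩ h
    have hoff (x) (hx : x ∉ A) : s x = t x := DFunLike.congr_fun h ⟨x, hx⟩
    have hmono {s : Equiv.Perm (Fin n)} (hs : StrictAntiOn s A) :
        StrictMono fun x : A => OrderDual.toDual (s x) := fun x y hxy => hs x.2 y.2 hxy
    have hcompl (s : Equiv.Perm (Fin n)) : s '' A = (s '' (A : Set (Fin n))ᶜ)ᶜ := by
      rw [Set.image_compl_eq s.bijective, compl_compl]
    have himg : s '' A = t '' A := by
      rw [hcompl, hcompl]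
      congr 1
      exact Set.image_congr fun x hx => hoff x hx
    have hon := (StrictMono.range_inj (hmono hs) (hmono ht)).1 (by
      have hr (s : Equiv.Perm (Fin n)) :
          Set.range (fun x : A => OrderDual.toDual (s x)) = OrderDual.toDual '' (s '' A) := by
        rw [Set.image_image, Set.image_eq_range]; rfl
      rw [hr, hr, himg])
    refine Subtype.ext (Equiv.ext fun x => ?_)
    by_cases hx : x ∈ A
    · exact congrFun hon ⟨x, hx⟩
    · exact hoff x hx
  refine (Nat.card_le_card_of_injective F hF).trans (le_of_eq ?_)
  rw [Nat.card_eq_fintype_card, Fintype.card_embedding_eq, Fintype.card_fin]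
  congr 1
  rw [Fintype.card_subtype_compl, Fintype.card_fin, Fintype.card_coe]

/-- Union bound for the existence of a decreasing subword of length `k`. -/
theorem card_exists_strictAntiOn_le (n k : ℕ) :
    Nat.card {s : Equiv.Perm (Fin n) // ∃ A : Finset (Fin n), A.card = k ∧ StrictAntiOn s A}
      * k.factorial ≤ n.choose k * n.factorial := by
  classical
  have h1 : Nat.card {s : Equiv.Perm (Fin n) //
      ∃ A : Finset (Fin n), A.card = k ∧ StrictAntiOn s A}
      ≤ ∑ A ∈ Finset.powersetCard k (Finset.univ : Finset (Fin n)), n.descFactorial (n - k) := by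
    rw [Nat.card_eq_fintype_card, Fintype.card_subtype]
    calc _ ≤ ((Finset.powersetCard k (Finset.univ : Finset (Fin n))).biUnion fun A =>
            Finset.univ.filter fun s : Equiv.Perm (Fin n) => StrictAntiOn s A).card := by
          refine Finset.card_le_card fun s hs => ?_
          obtain ⟨A, hA, hs⟩ := (Finset.mem_filter.1 hs).2
          simp only [Finset.mem_biUnion, Finset.mem_powersetCard_univ, Finset.mem_filter,
            Finset.mem_univ, true_and]
          exact ⟨A, hA, hs⟩
      _ ≤ _ := Finset.card_biUnion_le
      _ ≤ _ := by
          refine Finset.sum_le_sum fun A hA => ?_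
          rw [← Fintype.card_subtype, ← Nat.card_eq_fintype_card,
            ← (Finset.mem_powersetCard.1 hA).2]
          exact card_strictAntiOn_le A
  rw [Finset.sum_const, Finset.card_powersetCard, Finset.card_univ, Fintype.card_fin,
    smul_eq_mul] at h1
  refine (Nat.mul_le_mul_right _ h1).trans ?_
  rcases le_or_gt k n with hk | hk
  · have := Nat.factorial_mul_descFactorial (Nat.sub_le n k)
    rw [Nat.sub_sub_self hk] at this
    rw [mul_assoc, mul_comm (n.descFactorial _), this]
  · simp [Nat.choose_eq_zero_of_lt hk]

theorem card_linExt_permPoset_le {n : ℕ} (s : Equiv.Perm (Fin n)) (k : ℕ)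
    (hs : ¬ ∃ A : Finset (Fin n), A.card = k ∧ StrictAntiOn s A) :
    Nat.card (LinExt (PermPoset s) n) ≤ k ^ n := by
  refine card_linExt_le_pow n k (PermPoset s) (Fintype.card_fin n) fun A hA => ?_
  by_contra! hk
  obtain ⟨B, hBA, hB⟩ := Finset.exists_subset_card_eq hk.le
  refine hs ⟨B, hB, fun a ha b hb hab => ?_⟩
  by_contra! hle
  exact hA (hBA ha) (hBA hb) hab.ne (show (a, s a) ≤ (b, s b) from ⟨hab.le, hle⟩)

theorem card_linExt_permPoset_le_factorial {n : ℕ} (s : Equiv.Perm (Fin n)) :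
    Nat.card (LinExt (PermPoset s) n) ≤ n.factorial := by
  have h : Nat.card (PermPoset s ≃ Fin n) = n.factorial :=
    (Nat.card_perm (α := Fin n)).trans (by rw [Nat.card_fin])
  have : Finite (PermPoset s ≃ Fin n) := Nat.finite_of_card_ne_zero (by
    rw [h]; exact n.factorial_ne_zero)
  exact h ▸ Nat.card_le_card_of_injective Subtype.val Subtype.val_injective

/-- Split according to whether the word `s` has a decreasing subword of length `k`: this has
probability at most `2 ^ n / k!`, and otherwise `PermPoset s` has at most `k ^ n` linear
extensions. -/
theorem weakBruhatProb_le (n k : ℕ) :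
    weakBruhatProb n ≤ (k : ℝ) ^ n / n.factorial + (2 : ℝ) ^ n / k.factorial := by
  classical
  have h1 : noninvPairs n ≤ n.factorial * k ^ n + n.factorial *
      Nat.card {s : Equiv.Perm (Fin n) //
        ∃ A : Finset (Fin n), A.card = k ∧ StrictAntiOn s A} := by
    rw [noninvPairs_eq_sum]
    calc _ ≤ ∑ s : Equiv.Perm (Fin n), (k ^ n +
          if ∃ A : Finset (Fin n), A.card = k ∧ StrictAntiOn s A then n.factorial else 0) := by
          refine Finset.sum_le_sum fun s _ => ?_
          split_ifs with hs
          · exact (card_linExt_permPoset_le_factorial s).trans (Nat.le_add_left _ _)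
          · exact card_linExt_permPoset_le s k hs
      _ = _ := by
          rw [Finset.sum_add_distrib, ← Finset.sum_filter, Finset.sum_const, Finset.sum_const,
            Finset.card_univ, Fintype.card_perm, Fintype.card_fin, smul_eq_mul, smul_eq_mul,
            Nat.card_eq_fintype_card, Fintype.card_subtype, mul_comm n.factorial (Finset.card _)]
  have h2 := card_exists_strictAntiOn_le n k
  have h3 := Nat.choose_le_two_pow n k
  set b := Nat.card {s : Equiv.Perm (Fin n) //
        ∃ A : Finset (Fin n), A.card = k ∧ StrictAntiOn s A}
  have h4 : (b : ℝ) * k.factorial ≤ 2 ^ n * n.factorial := by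
    exact_mod_cast h2.trans (Nat.mul_le_mul_right _ h3)
  have h5 : (noninvPairs n : ℝ) ≤ n.factorial * k ^ n + n.factorial * b := by exact_mod_cast h1
  have hn : (0 : ℝ) < n.factorial := by positivity
  have hk : (0 : ℝ) < k.factorial := by positivity
  rw [weakBruhatProb_eq]
  calc _ ≤ (n.factorial * (k : ℝ) ^ n + n.factorial * b) / (n.factorial : ℝ) ^ 2 := by gcongr
    _ = (k : ℝ) ^ n / n.factorial + b / n.factorial := by field_simp
    _ ≤ _ := by
        gcongr (k : ℝ) ^ n / n.factorial + ?_
        rw [div_le_div_iff₀ hn hk]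
        exact h4

/-- `weakBruhatProb n` decays faster than every exponential. -/
theorem exists_weakBruhatProb_le {r : ℝ} (hr : 0 < r) :
    ∃ c : ℝ, 0 < c ∧ ∀ n : ℕ, weakBruhatProb n ≤ c * r ^ n := by
  obtain ⟨m, hm⟩ := exists_nat_ge (Real.exp 1 / r)
  have hm0 : (0 : ℝ) < m := lt_of_lt_of_le (by positivity) hm
  set B := max 1 (2 / r)
  have hB : 1 ≤ B := le_max_left _ _
  refine ⟨Real.exp m + Real.exp (B ^ m), by positivity, fun n => ?_⟩
  -- With `k` about `n / m`, the term `k ^ n / n!` is at most about `(e / m) ^ n ≤ r ^ n`, while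
  -- `1 / k!` beats every exponential in `n`.
  have hk1 : n ≤ m * (n / m + 1) :=
    (Nat.lt_mul_div_succ n (Nat.cast_pos.1 hm0)).le
  have hk2 : ((n / m + 1 : ℕ) : ℝ) ≤ (n + m : ℝ) / m := by
    rw [add_div, div_self hm0.ne']
    push_cast
    gcongr
    exact Nat.cast_div_le
  refine (weakBruhatProb_le n (n / m + 1)).trans ?_
  set k := n / m + 1
  rw [add_mul]
  refine add_le_add ?_ ?_
  · calc (k : ℝ) ^ n / n.factorial ≤ ((n + m : ℝ) / m) ^ n / n.factorial := by gcongr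
      _ = ((n + m : ℝ) ^ n / n.factorial) / m ^ n := by rw [div_pow, div_right_comm]
      _ ≤ Real.exp (n + m) / m ^ n := by
          gcongr
          exact Real.pow_div_factorial_le_exp _ (by positivity) n
      _ = Real.exp m * (Real.exp 1 / m) ^ n := by
          rw [Real.exp_add, div_pow, ← Real.exp_nat_mul, mul_one]; ring
      _ ≤ Real.exp m * r ^ n := by
          gcongr
          rwa [div_le_comm₀ hm0 hr]
  · have h1 : (2 / r) ^ n ≤ (B ^ m) ^ k := by
      rw [← pow_mul]
      calc (2 / r) ^ n ≤ B ^ n := by gcongr; exact le_max_right _ _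
        _ ≤ _ := pow_le_pow_right₀ hB hk1
    calc (2 : ℝ) ^ n / k.factorial = (2 / r) ^ n / k.factorial * r ^ n := by
          rw [div_pow]; field_simp
      _ ≤ (B ^ m) ^ k / k.factorial * r ^ n := by gcongr
      _ ≤ Real.exp (B ^ m) * r ^ n := by
          gcongr
          exact Real.pow_div_factorial_le_exp _ (by positivity) k

/-! ### The growth rate -/

theorem weakBruhatProb_nonneg (n : ℕ) : 0 ≤ weakBruhatProb n := measureReal_nonneg

/-- The growth rate is `0`. Fekete's lemma in the form `Subadditive.tendsto_lim` is not available,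
as `log (weakBruhatProb n) / n` is unbounded below. -/
theorem tendsto_weakBruhatProb_rpow :
    Tendsto (fun n : ℕ => weakBruhatProb n ^ (1 / (n : ℝ))) atTop (𝓝 0) := by
  rw [Metric.tendsto_atTop]
  intro ε hε
  obtain ⟨c, hc, h⟩ := exists_weakBruhatProb_le (half_pos hε)
  have hlim : Tendsto (fun n : ℕ => c ^ (1 / (n : ℝ))) atTop (𝓝 1) := by
    simpa using (tendsto_const_nhds (x := c)).rpow tendsto_one_div_atTop_nhds_zero_nat
      (Or.inl hc.ne')
  obtain ⟨N, hN⟩ := eventually_atTop.1 (hlim.eventually (gt_mem_nhds one_lt_two))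
  refine ⟨max N 1, fun n hn => ?_⟩
  have hn1 : (n : ℝ) ≠ 0 := by
    have := (le_max_right N 1).trans hn
    positivity
  have h0 := Real.rpow_nonneg (weakBruhatProb_nonneg n) (1 / (n : ℝ))
  rw [Real.dist_eq, sub_zero, abs_of_nonneg h0]
  calc weakBruhatProb n ^ (1 / (n : ℝ)) ≤ (c * (ε / 2) ^ n) ^ (1 / (n : ℝ)) :=
        Real.rpow_le_rpow (weakBruhatProb_nonneg n) (h n) (by positivity)
    _ = c ^ (1 / (n : ℝ)) * (ε / 2) := by
        rw [Real.mul_rpow hc.le (by positivity), ← Real.rpow_natCast,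
          ← Real.rpow_mul (by positivity), mul_one_div_cancel hn1, Real.rpow_one]
    _ < 2 * (ε / 2) := by
        gcongr
        exact hN n ((le_max_left N 1).trans hn)
    _ = ε := by ring

theorem theorem2 :
    (∀ n₁ n₂ : ℕ, 1 ≤ n₁ → 1 ≤ n₂ →
      weakBruhatProb (n₁ + n₂) ≤ weakBruhatProb n₁ * weakBruhatProb n₂) ∧
    (∃ c : ℝ, 0 < c ∧ ∀ n : ℕ, 1 ≤ n →
      ∏ i ∈ Finset.Icc 1 n, ((harmonic i : ℚ) : ℝ) / (i : ℝ) ≤ weakBruhatProb n ∧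
      weakBruhatProb n ≤ c * (0.362 : ℝ) ^ n) ∧
    (∃ ρ : ℝ, Tendsto (fun n : ℕ => weakBruhatProb n ^ (1 / (n : ℝ))) atTop (𝓝 ρ) ∧
      ρ ≤ 0.362) := by
  refine ⟨fun m n _ _ => weakBruhatProb_add_le m n, ?_,
    0, tendsto_weakBruhatProb_rpow, by norm_num⟩
  obtain ⟨c, hc, h⟩ := exists_weakBruhatProb_le (r := 0.362) (by norm_num)
  exact ⟨c, hc, fun n _ => ⟨prod_harmonic_div_le_weakBruhatProb n, h n⟩⟩
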